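/- Let $X$ be a separable real Banach space that contains a linear subspace isomorphic (that is, linearly homeomorphic) to $\ell_1$. Then there is an equivalent norm $|\cdot|$ on $X$ such that the bidual $(X,|\cdot|)^{**}$, with its bidual norm, is octahedral. Here a norm $\|\cdot\|$ on a real Banach space $V$ is called octahedral if for every finite-dimensional subspace $E$ of $V$ and every $\varepsilon>0$ there is $y\in V$ with $\|y\|=1$ such that $$\|x+y\|\ge(1-\varepsilon)\bigl(\|x\|+\|y\|\bigr)\quad\text{for all } x\in E.$$ -/

import Mathlib

/-- A real normed space `V` is octahedral: for every finite-dimensional subspace `E` and every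
`ε > 0` there is a unit vector `y` with `‖x + y‖ ≥ (1 - ε) (‖x‖ + ‖y‖)` for all `x ∈ E`. -/
def IsOctahedral (V : Type*) [NormedAddCommGroup V] [NormedSpace ℝ V] : Prop :=
  ∀ E : Submodule ℝ V, FiniteDimensional ℝ E → ∀ ε : ℝ, 0 < ε →
    ∃ y : V, ‖y‖ = 1 ∧ ∀ x ∈ E, (1 - ε) * (‖x‖ + ‖y‖) ≤ ‖x + y‖

/-- `X` contains a (linear) subspace that is linearly homeomorphic to `ℓ₁`. -/
def ContainsIsomorphicCopyOfEllOne (X : Type*) [NormedAddCommGroup X] [NormedSpace ℝ X] : Prop :=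
  ∃ Z : Submodule ℝ X, Nonempty (lp (fun _ : ℕ => ℝ) 1 ≃L[ℝ] Z)

/-- An equivalent norm on `X`: a seminorm `p` on the vector space `X` with
`c ‖x‖ ≤ p x ≤ C ‖x‖` for some constants `c, C > 0` (in particular, `p` is a norm). -/
structure EquivalentNorm (X : Type*) [NormedAddCommGroup X] [NormedSpace ℝ X] extends
    Seminorm ℝ X where
  equivalent : ∃ c C : ℝ, 0 < c ∧ 0 < C ∧ ∀ x : X, c * ‖x‖ ≤ toFun x ∧ toFun x ≤ C * ‖x‖

namespace EquivalentNorm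

/-- The renormed space `(X, p)`: the same vector space `X`, normed by `p` instead of by its
original norm. -/
def Renormed {X : Type*} [NormedAddCommGroup X] [NormedSpace ℝ X] (_p : EquivalentNorm X) :
    Type _ := X

instance {X : Type*} [NormedAddCommGroup X] [NormedSpace ℝ X] (p : EquivalentNorm X) :
    AddCommGroup p.Renormed :=
  inferInstanceAs (AddCommGroup X)

instance {X : Type*} [NormedAddCommGroup X] [NormedSpace ℝ X] (p : EquivalentNorm X) :
    Module ℝ p.Renormed :=
  inferInstanceAs (Module ℝ X)

instance {X : Type*} [NormedAddCommGroup X] [NormedSpace ℝ X] (p : EquivalentNorm X) :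
    Norm p.Renormed :=
  ⟨fun x => p.toSeminorm (show X from x)⟩

theorem renormed_core {X : Type*} [NormedAddCommGroup X] [NormedSpace ℝ X]
    (p : EquivalentNorm X) : NormedSpace.Core ℝ p.Renormed where
  norm_nonneg x := apply_nonneg p.toSeminorm (show X from x)
  norm_smul r x := map_smul_eq_mul p.toSeminorm r (show X from x)
  norm_triangle x y := map_add_le_add p.toSeminorm (show X from x) (show X from y)
  norm_eq_zero_iff x := by
    constructor
    · intro h
      obtain ⟨c, C, hc, -, hpc⟩ := p.equivalent
      have h1 : c * ‖(show X from x)‖ ≤ 0 := ((hpc (show X from x)).1).trans (le_of_eq h)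
      have h2 : ‖(show X from x)‖ ≤ 0 := by
        by_contra h3
        exact absurd h1 (not_le.mpr (mul_pos hc (not_le.mp h3)))
      exact norm_le_zero_iff.mp h2
    · intro h
      subst h
      exact map_zero p.toSeminorm

noncomputable instance {X : Type*} [NormedAddCommGroup X] [NormedSpace ℝ X] (p : EquivalentNorm X) :
    NormedAddCommGroup p.Renormed :=
  NormedAddCommGroup.ofCore p.renormed_core

noncomputable instance {X : Type*} [NormedAddCommGroup X] [NormedSpace ℝ X] (p : EquivalentNorm X) :
    NormedSpace ℝ p.Renormed :=
  NormedSpace.ofCore p.renormed_core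

end EquivalentNorm

/-! The bidual is octahedral as soon as, for unit vectors `y n` and every `η > 0`, some `N` makes
the mean of `‖x + t • y n‖` over `n < N` at least `‖x‖ + t - η‖x‖` for all `x` and `t ≥ 0`
(`isOctahedral_bidual_of_average`). By Hahn–Banach each `F` in the dual ball is then, up to `η`, a
mean of functionals `G n` in the ball with `G n (y n) = 1` (`exists_average_of_norming`). Apply this
to functionals almost norming finitely many unit vectors `u` of the bidual: averaging yields one `n`
that is good for every `u`, and `y n` is the required direction.

To get such a norm, take `e n` spanning `ℓ₁`. The dual ball realises every finite sign pattern on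
the `e n`, hence contains the leaves of dyadic trees. Norm `X` by root expectations of trees with
bounded biases, plus a small dual ball. Forcing the bias of level `n` makes a functional `f` norm `y
n = 4 • e n`. It changes `f` by the expectation of the leaves against a martingale difference, so by
orthogonality `N` such changes sum to norm at most `√(2N)` (`exists_rebias`), negligible against
`N`. A limit along an ultrafilter over the tree depth gives the norm
(`exists_equivalentNorm_of_norming_sets`). -/

open Filter Topology

/-! ### An averaging criterion for octahedral biduals -/

section BidualCriterion

/-- Hahn–Banach in factorized form: a functional dominated by a sublinear function pulled back along
a linear map `Φ` factors through `Φ`. -/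
theorem exists_linearMap_comp_eq_of_le_sublinear {V W : Type*} [AddCommGroup V] [Module ℝ V]
    [AddCommGroup W] [Module ℝ W] (Φ : V →ₗ[ℝ] W) (l : V →ₗ[ℝ] ℝ) (S : W → ℝ)
    (hS : ∀ c : ℝ, 0 < c → ∀ x, S (c • x) = c * S x) (hS' : ∀ x y, S (x + y) ≤ S x + S y)
    (hl : ∀ v, l v ≤ S (Φ v)) :
    ∃ G : W →ₗ[ℝ] ℝ, (∀ v, G (Φ v) = l v) ∧ ∀ w, G w ≤ S w := by
  have hS0 : S 0 = 0 := by
    have := hS 2 two_pos 0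
    rw [smul_zero] at this
    linarith
  have hker : LinearMap.ker Φ ≤ LinearMap.ker l := by
    intro v hv
    rw [LinearMap.mem_ker] at hv ⊢
    have h1 := hl v
    have h2 := hl (-v)
    rw [map_neg, map_neg, hv, neg_zero, hS0] at h2
    rw [hv, hS0] at h1
    linarith
  let g : LinearMap.range Φ →ₗ[ℝ] ℝ :=
    ((LinearMap.ker Φ).liftQ l hker).comp Φ.quotKerEquivRange.symm.toLinearMap
  have hg : ∀ v, g ⟨Φ v, LinearMap.mem_range_self Φ v⟩ = l v := by
    intro v
    have : Φ.quotKerEquivRange.symm ⟨Φ v, LinearMap.mem_range_self Φ v⟩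
        = (LinearMap.ker Φ).mkQ v := LinearMap.quotKerEquivRange_symm_apply_image Φ v _
    simp [g, this]
  obtain ⟨G, hG, hGS⟩ := exists_extension_of_le_sublinear ⟨LinearMap.range Φ, g⟩ S hS hS' (by
    rintro ⟨_, v, rfl⟩
    exact (hg v).le.trans (hl v))
  exact ⟨G, fun v => (hG ⟨Φ v, LinearMap.mem_range_self Φ v⟩).trans (hg v), hGS⟩

variable {Z : Type*} [NormedAddCommGroup Z] [NormedSpace ℝ Z]

theorem exists_strongDual_of_le_norm (g : Z →ₗ[ℝ] ℝ) (C : ℝ) (hC : 0 ≤ C)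
    (hg : ∀ z, g z ≤ C * ‖z‖) : ∃ f : StrongDual ℝ Z, ‖f‖ ≤ C ∧ ∀ z, f z = g z := by
  have h : ∀ z, ‖g z‖ ≤ C * ‖z‖ := fun z => by
    rw [Real.norm_eq_abs, abs_le]
    have := hg (-z)
    rw [map_neg, norm_neg] at this
    exact ⟨by linarith, hg z⟩
  exact ⟨g.mkContinuous C h, g.mkContinuous_norm_le hC h, fun z => rfl⟩

/-- If on average over `n < N` the norm is almost additive between `x` and `t • y n`, then every
functional in the dual ball is almost an average of functionals norming the `y n`. -/
theorem exists_average_of_norming {y : ℕ → Z} (hy : ∀ n, ‖y n‖ ≤ 1) {N : ℕ} (hN : 0 < N) {η : ℝ}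
    (hη : 0 ≤ η)
    (h : ∀ x : Z, ∀ t : ℝ, 0 ≤ t →
      N * (‖x‖ + t) ≤ ∑ n ∈ Finset.range N, ‖x + t • y n‖ + N * η * ‖x‖)
    (F : StrongDual ℝ Z) (hF : ‖F‖ ≤ 1) :
    ∃ (G : ℕ → StrongDual ℝ Z) (r : StrongDual ℝ Z), (∀ n, ‖G n‖ ≤ 1) ∧
      (∀ n < N, G n (y n) = 1) ∧ ‖r‖ ≤ N * η ∧
      (N : ℝ) • F = ∑ n ∈ Finset.range N, G n + r := by
  -- The coordinates `x + t • y n` will carry the functionals `G n`; the extra copy of `x` carries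
  -- the error `r`.
  let Φ : Z × ℝ →ₗ[ℝ] (ℕ → Z) × Z :=
    (LinearMap.pi fun n => LinearMap.fst ℝ Z ℝ + (LinearMap.snd ℝ Z ℝ).smulRight (y n)).prod
      (LinearMap.fst ℝ Z ℝ)
  let l : Z × ℝ →ₗ[ℝ] ℝ :=
    (N : ℝ) • (F.toLinearMap.comp (LinearMap.fst ℝ Z ℝ) + LinearMap.snd ℝ Z ℝ)
  have hN' : (0 : ℝ) < N := by exact_mod_cast hN
  have hFle : ∀ x, F x ≤ ‖x‖ := fun x =>
    (le_abs_self _).trans ((F.le_of_opNorm_le hF x).trans (one_mul _).le)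
  obtain ⟨G, hG, hGS⟩ := exists_linearMap_comp_eq_of_le_sublinear Φ l
    (fun w => ∑ n ∈ Finset.range N, ‖w.1 n‖ + N * η * ‖w.2‖)
    (by
      intro c hc w
      simp only [Prod.smul_fst, Prod.smul_snd, Pi.smul_apply, norm_smul, Real.norm_eq_abs,
        abs_of_pos hc, ← Finset.mul_sum]
      ring)
    (by
      intro v w
      have h1 : ∑ n ∈ Finset.range N, ‖(v + w).1 n‖
          ≤ ∑ n ∈ Finset.range N, ‖v.1 n‖ + ∑ n ∈ Finset.range N, ‖w.1 n‖ := by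
        rw [← Finset.sum_add_distrib]
        exact Finset.sum_le_sum fun n _ => norm_add_le _ _
      have h2 : N * η * ‖(v + w).2‖ ≤ N * η * (‖v.2‖ + ‖w.2‖) := by
        gcongr
        exact norm_add_le _ _
      linarith)
    (by
      rintro ⟨x, t⟩
      change (N : ℝ) * (F x + t) ≤ ∑ n ∈ Finset.range N, ‖x + t • y n‖ + N * η * ‖x‖
      rcases le_total 0 t with ht | ht
      · refine le_trans ?_ (h x t ht)
        have := hFle x
        gcongr
      · have h1 : ∑ n ∈ Finset.range N, (F x + t) ≤ ∑ n ∈ Finset.range N, ‖x + t • y n‖ := by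
          refine Finset.sum_le_sum fun n _ => ?_
          have h2 : ‖x‖ ≤ ‖x + t • y n‖ + ‖t • y n‖ := by
            simpa using norm_sub_le (x + t • y n) (t • y n)
          have h3 : ‖t • y n‖ ≤ -t := by
            rw [norm_smul, Real.norm_eq_abs, abs_of_nonpos ht]
            nlinarith [hy n]
          linarith [hFle x]
        rw [Finset.sum_const, Finset.card_range, nsmul_eq_mul] at h1
        have : 0 ≤ N * η * ‖x‖ := by positivity
        linarith)
  have hcomp : ∀ n, ∃ f : StrongDual ℝ Z, ‖f‖ ≤ 1 ∧
      ∀ z, f z = if n < N then G (Pi.single n z, 0) else 0 := by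
    intro n
    by_cases hn : n < N
    · obtain ⟨f, hf, hfz⟩ := exists_strongDual_of_le_norm
        (G.comp ((LinearMap.inl ℝ (ℕ → Z) Z).comp (LinearMap.single ℝ (fun _ : ℕ => Z) n)))
        1 zero_le_one (by
          intro z
          refine (hGS (Pi.single n z, 0)).trans ?_
          simp only [norm_zero, mul_zero, add_zero, one_mul]
          rw [Finset.sum_eq_single n]
          · simp
          · intro b _ hb
            simp [Pi.single_eq_of_ne hb]
          · intro hb
            exact absurd (Finset.mem_range.2 hn) hb)
      exact ⟨f, hf, fun z => by rw [hfz, if_pos hn]; rfl⟩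
    · exact ⟨0, by simp, fun z => by simp [hn]⟩
  choose f hf hfz using hcomp
  obtain ⟨r, hr, hrz⟩ := exists_strongDual_of_le_norm (G.comp (LinearMap.inr ℝ (ℕ → Z) Z))
    (N * η) (by positivity) (by
      intro z
      refine (hGS (0, z)).trans ?_
      simp)
  have htail : ∀ u : ℕ → Z, (∀ n < N, u n = 0) → G (u, 0) = 0 := by
    intro u hu
    have hs : ∀ u : ℕ → Z, (∀ n < N, u n = 0) → G (u, 0) ≤ 0 := by
      intro u hu
      refine (hGS (u, 0)).trans ?_
      simp only [norm_zero, mul_zero, add_zero]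
      exact (Finset.sum_eq_zero fun n hn => by simp [hu n (Finset.mem_range.1 hn)]).le
    have h1 := hs u hu
    have h2 := hs (-u) (fun n hn => by simp [hu n hn])
    have h3 : ((-u, 0) : (ℕ → Z) × Z) = -(u, 0) := by simp
    rw [h3, map_neg] at h2
    linarith
  have hdec : ∀ u z, G (u, z) = ∑ n ∈ Finset.range N, f n (u n) + r z := by
    intro u z
    have h1 : ((u, z) : (ℕ → Z) × Z)
        = ∑ n ∈ Finset.range N, (LinearMap.inl ℝ (ℕ → Z) Z) (Pi.single n (u n))
          + (LinearMap.inl ℝ (ℕ → Z) Z) (u - ∑ n ∈ Finset.range N, Pi.single n (u n))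
          + (LinearMap.inr ℝ (ℕ → Z) Z) z := by
      rw [← map_sum, ← map_add]
      simp
    rw [h1, map_add, map_add, map_sum, hrz]
    have h2 : G ((LinearMap.inl ℝ (ℕ → Z) Z) (u - ∑ n ∈ Finset.range N, Pi.single n (u n))) = 0 := by
      refine htail _ fun n hn => ?_
      change (u - ∑ m ∈ Finset.range N, Pi.single m (u m) : ℕ → Z) n = 0
      rw [Pi.sub_apply, Finset.sum_apply, Finset.sum_eq_single n]
      · simp
      · intro b _ hb
        simp [Pi.single_eq_of_ne hb.symm]
      · intro hb
        exact absurd (Finset.mem_range.2 hn) hb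
    rw [h2, add_zero]
    congr 1
    refine Finset.sum_congr rfl fun n hn => ?_
    rw [hfz, if_pos (Finset.mem_range.1 hn)]
    rfl
  have hmain : ∀ x t, (N : ℝ) * (F x + t) = ∑ n ∈ Finset.range N, f n (x + t • y n) + r x := by
    intro x t
    have := hG (x, t)
    rw [show Φ (x, t) = (fun n => x + t • y n, x) from rfl, hdec] at this
    exact this.symm
  refine ⟨f, r, hf, ?_, hr, ?_⟩
  -- The values `f n (y n)` are at most `1` and sum to `N` (take `x = 0`, `t = 1`), so each equals
  -- `1`.
  · have hle : ∀ n ∈ Finset.range N, f n (y n) ≤ 1 := fun n _ =>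
      (le_abs_self _).trans (((f n).le_of_opNorm_le (hf n) _).trans (by simpa using hy n))
    have hsum : ∑ n ∈ Finset.range N, f n (y n) = ∑ n ∈ Finset.range N, (1 : ℝ) := by
      have := hmain 0 1
      simp at this
      simp [this]
    intro n hn
    exact (Finset.sum_eq_sum_iff_of_le hle).1 hsum n (Finset.mem_range.2 hn)
  · ext x
    have := hmain x 0
    simp only [zero_smul, add_zero] at this
    simpa using this

/-- Octahedrality only has to be tested on finite sets of unit vectors. -/
theorem isOctahedral_of_finset (h : ∀ T : Finset Z, (∀ u ∈ T, ‖u‖ = 1) → ∀ ε : ℝ, 0 < ε →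
    ∃ y : Z, ‖y‖ = 1 ∧ ∀ u ∈ T, ∀ t : ℝ, 0 ≤ t → t * (1 - ε) + 1 ≤ ‖t • u + y‖) :
    IsOctahedral Z := by
  classical
  intro E hE ε hε
  have := FiniteDimensional.proper_real E
  obtain ⟨T, hT, hfin, hcov⟩ := (isCompact_sphere (0 : E) 1).finite_cover_balls (half_pos hε)
  obtain ⟨y, hy, hyT⟩ := h (hfin.toFinset.image (fun u : E => (u : Z))) (by
    intro u hu
    obtain ⟨v, hv, rfl⟩ := Finset.mem_image.1 hu
    simpa using hT (hfin.mem_toFinset.1 hv)) (ε / 2) (half_pos hε)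
  refine ⟨y, hy, fun x hx => ?_⟩
  rw [hy]
  rcases eq_or_ne x 0 with rfl | hx0
  · rw [norm_zero, zero_add, zero_add, hy]
    linarith
  have hxn : 0 < ‖x‖ := norm_pos_iff.2 hx0
  let u : E := (‖x‖⁻¹) • ⟨x, hx⟩
  have hu : ‖u‖ = 1 := by
    change ‖(‖x‖⁻¹) • x‖ = 1
    rw [norm_smul, norm_inv, norm_norm, inv_mul_cancel₀ hxn.ne']
  obtain ⟨v, hv, huv⟩ := Set.mem_iUnion₂.1
    (hcov (show u ∈ Metric.sphere (0 : E) 1 by simpa using hu))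
  rw [Metric.mem_ball, dist_eq_norm] at huv
  have hxu : x = ‖x‖ • (u : Z) := by
    change x = ‖x‖ • ((‖x‖⁻¹) • x)
    rw [smul_smul, mul_inv_cancel₀ hxn.ne', one_smul]
  have h1 := hyT v (Finset.mem_image_of_mem _ (hfin.mem_toFinset.2 hv)) ‖x‖ hxn.le
  have h2 : ‖‖x‖ • (v : Z) + y‖ ≤ ‖x + y‖ + ‖x‖ * (ε / 2) := by
    have h3 : ‖x‖ • (v : Z) + y = (x + y) - ‖x‖ • ((u - v : E) : Z) := by
      rw [Submodule.coe_sub, smul_sub, ← hxu]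
      abel
    rw [h3]
    refine (norm_sub_le _ _).trans ?_
    rw [norm_smul, norm_norm]
    gcongr
    exact huv.le
  nlinarith

/-- If the norm of `Z` is, on average over `n < N`, almost additive between `x` and the positive
multiples of `y n`, then the bidual of `Z` is octahedral. -/
theorem isOctahedral_bidual_of_average {y : ℕ → Z} (hy : ∀ n, ‖y n‖ = 1)
    (h : ∀ η : ℝ, 0 < η → ∃ N : ℕ, 0 < N ∧ ∀ x : Z, ∀ t : ℝ, 0 ≤ t →
      N * (‖x‖ + t) ≤ ∑ n ∈ Finset.range N, ‖x + t • y n‖ + N * η * ‖x‖) :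
    IsOctahedral (StrongDual ℝ (StrongDual ℝ Z)) := by
  refine isOctahedral_of_finset fun T hT ε hε => ?_
  -- Each `u ∈ T` loses `δ` by not attaining its norm and `δ` through the remainder `r`; the total
  -- over `T` must stay below `ε`.
  set δ : ℝ := ε / (2 * (T.card + 1)) with hδ
  have hcard : (0 : ℝ) < T.card + 1 := by positivity
  have hδ0 : 0 < δ := by positivity
  obtain ⟨N, hN, hNh⟩ := h δ hδ0
  have hN' : (0 : ℝ) < N := by exact_mod_cast hN
  have hle : ∀ u : StrongDual ℝ (StrongDual ℝ Z), ‖u‖ = 1 → ∀ f, u f ≤ ‖f‖ := fun u hu f =>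
    (le_abs_self _).trans ((u.le_of_opNorm_le hu.le f).trans (one_mul _).le)
  have hF : ∀ u : StrongDual ℝ (StrongDual ℝ Z), ‖u‖ = 1 →
      ∃ F : StrongDual ℝ Z, ‖F‖ ≤ 1 ∧ 1 - δ ≤ u F := by
    intro u hu
    by_contra! hcon
    have hle : ‖u‖ ≤ max (1 - δ) 0 := by
      refine ContinuousLinearMap.opNorm_le_of_unit_norm (le_max_right _ _) fun F hF => ?_
      rw [Real.norm_eq_abs, abs_le]
      have h1 := hcon F hF.le
      have h2 := hcon (-F) (by rw [norm_neg]; exact hF.le)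
      rw [map_neg] at h2
      have := le_max_left (1 - δ) 0
      constructor <;> linarith
    rw [hu] at hle
    rcases le_max_iff.1 hle with h1 | h1 <;> linarith
  have hdec : ∀ u : StrongDual ℝ (StrongDual ℝ Z), ∃ G : ℕ → StrongDual ℝ Z, ‖u‖ = 1 →
      (∀ n, ‖G n‖ ≤ 1) ∧ (∀ n < N, G n (y n) = 1) ∧
      N * (1 - 2 * δ) ≤ ∑ n ∈ Finset.range N, u (G n) := by
    intro u
    by_cases hu : ‖u‖ = 1
    · obtain ⟨F, hF1, hFu⟩ := hF u hu
      obtain ⟨G, r, hG1, hGy, hr, hsum⟩ :=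
        exists_average_of_norming (fun n => (hy n).le) hN hδ0.le hNh F hF1
      refine ⟨G, fun _ => ⟨hG1, hGy, ?_⟩⟩
      have h1 := congrArg u hsum
      rw [map_smul, map_add, map_sum, smul_eq_mul] at h1
      have h2 : u r ≤ N * δ := (hle u hu r).trans hr
      have h3 := mul_le_mul_of_nonneg_left hFu hN'.le
      linarith
    · exact ⟨0, fun h => absurd h hu⟩
  choose G hG using hdec
  obtain ⟨n, hn, hnsum⟩ : ∃ n ∈ Finset.range N,
      (T.card : ℝ) * (1 - 2 * δ) ≤ ∑ u ∈ T, u (G u n) := by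
    refine Finset.exists_le_of_sum_le (Finset.nonempty_range_iff.2 hN.ne') ?_
    rw [Finset.sum_comm, Finset.sum_const, Finset.card_range, nsmul_eq_mul]
    have : ∑ u ∈ T, (N : ℝ) * (1 - 2 * δ) ≤ ∑ u ∈ T, ∑ n ∈ Finset.range N, u (G u n) :=
      Finset.sum_le_sum fun u hu => (hG u (hT u hu)).2.2
    rw [Finset.sum_const, nsmul_eq_mul] at this
    linarith
  have hle1 : ∀ u ∈ T, u (G u n) ≤ 1 := fun u hu =>
    (hle u (hT u hu) _).trans ((hG u (hT u hu)).1 n)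
  -- All deficits `1 - u (G u n)` are nonnegative, so each is bounded by their sum.
  have hge : ∀ u ∈ T, 1 - ε ≤ u (G u n) := by
    intro u hu
    have h1 : ∑ v ∈ T, (1 - v (G v n)) ≤ T.card * (2 * δ) := by
      rw [Finset.sum_sub_distrib, Finset.sum_const, nsmul_eq_mul]
      linarith
    have h2 : 1 - u (G u n) ≤ ∑ v ∈ T, (1 - v (G v n)) :=
      Finset.single_le_sum (f := fun v => 1 - v (G v n)) (fun v hv => sub_nonneg.2 (hle1 v hv)) hu
    have h3 : (T.card + 1 : ℝ) * (2 * δ) = ε := by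
      rw [hδ]
      field_simp
    nlinarith
  refine ⟨NormedSpace.inclusionInDoubleDual ℝ Z (y n),
    ((NormedSpace.inclusionInDoubleDualLi ℝ (E := Z)).norm_map (y n)).trans (hy n), ?_⟩
  intro u hu t ht
  obtain ⟨hG1, hGy, -⟩ := hG u (hT u hu)
  set w := t • u + NormedSpace.inclusionInDoubleDual ℝ Z (y n) with hw
  have h2 : w (G u n) = t * u (G u n) + 1 := by
    rw [← hGy n (Finset.mem_range.1 hn)]
    rfl
  have h3 : w (G u n) ≤ ‖w‖ * ‖G u n‖ := (le_abs_self _).trans (w.le_opNorm (G u n))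
  have h4 := mul_le_mul_of_nonneg_left (hge u hu) ht
  have h5 := mul_le_mul_of_nonneg_left (hG1 n) (norm_nonneg w)
  linarith

end BidualCriterion

/-! ### Dual-valued trees and changes of bias -/

section BiasedTrees

variable {X : Type*} [NormedAddCommGroup X] [NormedSpace ℝ X]

/-- The expectations at the root of dual-valued trees of depth `k` whose first split is labelled by
`e m`. The leaves are functionals `φ` in the dual ball with `φ (e i) = s i` for all `i` below the
depth, where `s i = ±1` records the branch taken at the split `i`; the bias `b` of the split `m`
satisfies `|σ (e m) + b| ≤ 1 / 4`. -/
def biasedTree (e : ℕ → X) (σ : StrongDual ℝ X) : ℕ → ℕ → (ℕ → ℝ) → Set (StrongDual ℝ X)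
  | 0, m, s => {φ | ‖φ‖ ≤ 1 ∧ ∀ i < m, φ (e i) = s i}
  | k + 1, m, s => {f | ∃ b : ℝ, |σ (e m) + b| ≤ 1 / 4 ∧
      ∃ g ∈ biasedTree e σ k (m + 1) (Function.update s m 1),
      ∃ h ∈ biasedTree e σ k (m + 1) (Function.update s m (-1)),
        f = ((1 + b) / 2) • g + ((1 - b) / 2) • h}

variable {e : ℕ → X} {σ : StrongDual ℝ X}

theorem apply_of_mem_biasedTree {k m : ℕ} {s : ℕ → ℝ} {f : StrongDual ℝ X}
    (hf : f ∈ biasedTree e σ k m s) : ∀ i < m, f (e i) = s i := by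
  induction k generalizing m s f with
  | zero => exact hf.2
  | succ k ih =>
    obtain ⟨b, -, g, hg, h, hh, rfl⟩ := hf
    intro i hi
    have h1 := ih hg i (by omega)
    have h2 := ih hh i (by omega)
    rw [Function.update_of_ne hi.ne] at h1 h2
    simp only [add_apply, smul_apply, smul_eq_mul, h1, h2]
    ring

theorem apply_split_of_mem_biasedTree {k m : ℕ} {s : ℕ → ℝ} {g h : StrongDual ℝ X}
    (hg : g ∈ biasedTree e σ k (m + 1) (Function.update s m 1))
    (hh : h ∈ biasedTree e σ k (m + 1) (Function.update s m (-1))) (b : ℝ) :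
    (((1 + b) / 2) • g + ((1 - b) / 2) • h) (e m) = b := by
  have h1 := apply_of_mem_biasedTree hg m (by omega)
  have h2 := apply_of_mem_biasedTree hh m (by omega)
  rw [Function.update_self] at h1 h2
  simp only [add_apply, smul_apply, smul_eq_mul, h1, h2]
  ring

/-- Keeps both branch weights `(1 ± b) / 2` at least `1 / 4`, which bounds the variance in
`exists_rebias`. -/
theorem abs_bias_le (hσ : ∀ i, |σ (e i)| ≤ 1 / 4) {m : ℕ} {b : ℝ} (hb : |σ (e m) + b| ≤ 1 / 4) :
    |b| ≤ 1 / 2 := by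
  have h1 := abs_le.1 (hσ m)
  have h2 := abs_le.1 hb
  exact abs_le.2 ⟨by linarith, by linarith⟩

theorem norm_le_of_mem_biasedTree (hσ : ∀ i, |σ (e i)| ≤ 1 / 4) {k m : ℕ} {s : ℕ → ℝ}
    {f : StrongDual ℝ X} (hf : f ∈ biasedTree e σ k m s) : ‖f‖ ≤ 1 := by
  induction k generalizing m s f with
  | zero => exact hf.1
  | succ k ih =>
    obtain ⟨b, hb, g, hg, h, hh, rfl⟩ := hf
    have hb' := abs_le.1 (abs_bias_le hσ hb)
    have h1 := ih hg
    have h2 := ih hh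
    refine (norm_add_le _ _).trans ?_
    rw [norm_smul, norm_smul, Real.norm_of_nonneg (by linarith), Real.norm_of_nonneg (by linarith)]
    nlinarith

theorem abs_add_apply_le_of_mem_biasedTree (hσ : ∀ i, |σ (e i)| ≤ 1 / 4) {k m : ℕ} {s : ℕ → ℝ}
    {f : StrongDual ℝ X} (hf : f ∈ biasedTree e σ k m s) {i : ℕ} (hi : m ≤ i) (hi' : i < m + k) :
    |σ (e i) + f (e i)| ≤ 1 / 4 := by
  induction k generalizing m s f with
  | zero => omega
  | succ k ih =>
    obtain ⟨b, hb, g, hg, h, hh, rfl⟩ := hf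
    rcases eq_or_lt_of_le hi with rfl | hlt
    · rwa [apply_split_of_mem_biasedTree hg hh]
    · have hb' := abs_le.1 (abs_bias_le hσ hb)
      have h1 := abs_le.1 (ih hg (by omega) (by omega))
      have h2 := abs_le.1 (ih hh (by omega) (by omega))
      simp only [add_apply, smul_apply, smul_eq_mul]
      rw [abs_le]
      constructor <;> nlinarith

/-- With all biases zero, the constraint on a split reduces to the bound on `σ (e m)`. Hence one `f`
serves all `σ`, and `σ` may be chosen after `f`. -/
theorem exists_mem_biasedTree
    (he : ∀ (m : ℕ) (s : ℕ → ℝ), (∀ i, |s i| ≤ 1) →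
      ∃ φ : StrongDual ℝ X, ‖φ‖ ≤ 1 ∧ ∀ i < m, φ (e i) = s i)
    (k m : ℕ) {s : ℕ → ℝ} (hs : ∀ i, |s i| ≤ 1) :
    ∃ f, ∀ σ : StrongDual ℝ X, (∀ i, |σ (e i)| ≤ 1 / 4) → f ∈ biasedTree e σ k m s := by
  induction k generalizing m s with
  | zero =>
    obtain ⟨φ, hφ⟩ := he m s hs
    exact ⟨φ, fun _ _ => hφ⟩
  | succ k ih =>
    have hup : ∀ a : ℝ, |a| ≤ 1 → ∀ i, |Function.update s m a i| ≤ 1 := by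
      intro a ha i
      rcases eq_or_ne i m with rfl | hi
      · rwa [Function.update_self]
      · rw [Function.update_of_ne hi]
        exact hs i
    obtain ⟨g, hg⟩ := ih (m + 1) (hup 1 (by simp))
    obtain ⟨h, hh⟩ := ih (m + 1) (hup (-1) (by simp))
    exact ⟨_, fun σ hσ => ⟨0, by simpa using hσ m, g, hg σ hσ, h, hh σ hσ, rfl⟩⟩

/-- Resetting the bias of a single split `n` to a prescribed value changes the root expectation only
by a martingale difference, so that these changes satisfy an orthogonality estimate. -/
theorem exists_rebias (hσ : ∀ i, |σ (e i)| ≤ 1 / 4) {v : ℝ} (hv : |v| ≤ 1 / 4) {k m : ℕ}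
    {s : ℕ → ℝ} {f : StrongDual ℝ X} (hf : f ∈ biasedTree e σ k m s) :
    ∃ F : ℕ → StrongDual ℝ X,
      (∀ n, m ≤ n → n < m + k → F n ∈ biasedTree e σ k m s ∧ σ (e n) + F n (e n) = v) ∧
      ∀ (θ : ℕ → ℝ) (a : ℝ), ‖a • f + ∑ n ∈ Finset.Ico m (m + k), θ n • (F n - f)‖
        ≤ √(a ^ 2 + 2 * ∑ n ∈ Finset.Ico m (m + k), θ n ^ 2) := by
  induction k generalizing m s f with
  | zero =>
    refine ⟨0, fun n h1 h2 => by omega, fun θ a => ?_⟩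
    simp only [add_zero, Finset.Ico_self, Finset.sum_empty, mul_zero, Real.sqrt_sq_eq_abs,
      norm_smul, Real.norm_eq_abs]
    exact mul_le_of_le_one_right (abs_nonneg a) hf.1
  | succ k ih =>
    obtain ⟨b, hb, g, hg, h, hh, rfl⟩ := hf
    obtain ⟨G, hG, hGn⟩ := ih hg
    obtain ⟨H, hH, hHn⟩ := ih hh
    have hb' := abs_le.1 (abs_bias_le hσ hb)
    set c := v - σ (e m) with hc
    have hcv : |σ (e m) + c| ≤ 1 / 4 := by
      rw [hc]
      simpa using hv
    have hc' := abs_le.1 (abs_bias_le hσ hcv)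
    set p := (1 + b) / 2 with hp
    set q := (1 - b) / 2 with hq
    have hp4 : 1 / 4 ≤ p := by linarith
    have hq4 : 1 / 4 ≤ q := by linarith
    have hpq : p + q = 1 := by rw [hp, hq]; ring
    -- At the top split the bias becomes `c`; for a deeper level both subtrees are rebiased and the
    -- top weights are kept.
    let F : ℕ → StrongDual ℝ X := fun n =>
      if n = m then ((1 + c) / 2) • g + ((1 - c) / 2) • h else p • G n + q • H n
    have hFm : F m = ((1 + c) / 2) • g + ((1 - c) / 2) • h := if_pos rfl
    have hFn : ∀ n, n ≠ m → F n = p • G n + q • H n := fun n hn => if_neg hn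
    refine ⟨F, ?_, ?_⟩
    · intro n hn hn'
      rcases eq_or_lt_of_le hn with rfl | hlt
      · rw [hFm]
        refine ⟨⟨c, hcv, g, hg, h, hh, rfl⟩, ?_⟩
        rw [apply_split_of_mem_biasedTree hg hh, hc]
        ring
      · rw [hFn n hlt.ne']
        obtain ⟨h1, h2⟩ := hG n (by omega) (by omega)
        obtain ⟨h3, h4⟩ := hH n (by omega) (by omega)
        refine ⟨⟨b, hb, _, h1, _, h3, rfl⟩, ?_⟩
        simp only [add_apply, smul_apply, smul_eq_mul]
        have : q = 1 - p := by linarith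
        rw [this]
        linear_combination p * h2 + (1 - p) * h4
    · intro θ a
      have hm : m + (k + 1) = m + 1 + k := by omega
      have hlt : m < m + 1 + k := by omega
      rw [hm, Finset.sum_eq_sum_Ico_succ_bot hlt (fun n => θ n • (F n - (p • g + q • h))),
        Finset.sum_eq_sum_Ico_succ_bot hlt (fun n => θ n ^ 2), hFm]
      set d := (c - b) / 2 with hd
      have hd' : |d| ≤ 1 / 2 := abs_le.2 ⟨by linarith, by linarith⟩
      set Q := ∑ n ∈ Finset.Ico (m + 1) (m + 1 + k), θ n ^ 2 with hQ
      have hQ0 : 0 ≤ Q := Finset.sum_nonneg fun n _ => sq_nonneg _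
      have hp0 : 0 < p := by linarith
      have hq0 : 0 < q := by linarith
      -- Moving the top bias replaces `a` by a two-valued variable with mean `a` and variance `θ m ^
      -- 2 * (d ^ 2 / p + d ^ 2 / q)`; this is why the induction carries a general `a`.
      set a₁ := a + θ m * d / p with ha₁
      set a₂ := a - θ m * d / q with ha₂
      have hsum : a • (p • g + q • h) + (θ m • (((1 + c) / 2) • g + ((1 - c) / 2) • h
            - (p • g + q • h))
          + ∑ n ∈ Finset.Ico (m + 1) (m + 1 + k), θ n • (F n - (p • g + q • h)))
          = p • (a₁ • g + ∑ n ∈ Finset.Ico (m + 1) (m + 1 + k), θ n • (G n - g))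
            + q • (a₂ • h + ∑ n ∈ Finset.Ico (m + 1) (m + 1 + k), θ n • (H n - h)) := by
        have h1 : ∑ n ∈ Finset.Ico (m + 1) (m + 1 + k), θ n • (F n - (p • g + q • h))
            = p • ∑ n ∈ Finset.Ico (m + 1) (m + 1 + k), θ n • (G n - g)
              + q • ∑ n ∈ Finset.Ico (m + 1) (m + 1 + k), θ n • (H n - h) := by
          rw [Finset.smul_sum, Finset.smul_sum, ← Finset.sum_add_distrib]
          refine Finset.sum_congr rfl fun n hn => ?_
          rw [hFn n (by have := (Finset.mem_Ico.1 hn).1; omega)]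
          module
        have h2 : p * a₁ = p * a + θ m * d := by rw [ha₁]; field_simp
        have h3 : q * a₂ = q * a - θ m * d := by rw [ha₂]; field_simp
        have h4 : (1 + c) / 2 = p + d := by rw [hp, hd]; ring
        have h5 : (1 - c) / 2 = q - d := by rw [hq, hd]; ring
        rw [h1, smul_add p, smul_add q, smul_smul p, smul_smul q, h2, h3, h4, h5]
        module
      rw [hsum]
      have hn1 := hGn θ a₁
      have hn2 := hHn θ a₂
      rw [← hQ] at hn1 hn2
      set r₁ := √(a₁ ^ 2 + 2 * Q) with hr₁
      set r₂ := √(a₂ ^ 2 + 2 * Q) with hr₂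
      have hr₁sq : r₁ ^ 2 = a₁ ^ 2 + 2 * Q := Real.sq_sqrt (by positivity)
      have hr₂sq : r₂ ^ 2 = a₂ ^ 2 + 2 * Q := Real.sq_sqrt (by positivity)
      calc _ ≤ p * r₁ + q * r₂ := by
            refine (norm_add_le _ _).trans ?_
            rw [norm_smul, norm_smul, Real.norm_of_nonneg hp0.le, Real.norm_of_nonneg hq0.le]
            gcongr
        _ ≤ √(a ^ 2 + 2 * (θ m ^ 2 + Q)) := by
            refine Real.le_sqrt_of_sq_le ?_
            have hjensen : (p * r₁ + q * r₂) ^ 2 ≤ p * r₁ ^ 2 + q * r₂ ^ 2 := by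
              have h1 : p * r₁ ^ 2 + q * r₂ ^ 2 - (p * r₁ + q * r₂) ^ 2
                  = p * q * (r₁ - r₂) ^ 2 := by
                have : q = 1 - p := by linarith
                rw [this]
                ring
              have : 0 ≤ p * q * (r₁ - r₂) ^ 2 := by positivity
              linarith
            have hvar : p * a₁ ^ 2 + q * a₂ ^ 2 = a ^ 2 + θ m ^ 2 * (d ^ 2 / p + d ^ 2 / q) := by
              have h1 : p * a₁ ^ 2 = p * a ^ 2 + 2 * a * (θ m * d) + θ m ^ 2 * (d ^ 2 / p) := by
                rw [ha₁]
                field_simp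
                ring
              have h2 : q * a₂ ^ 2 = q * a ^ 2 - 2 * a * (θ m * d) + θ m ^ 2 * (d ^ 2 / q) := by
                rw [ha₂]
                field_simp
                ring
              rw [h1, h2]
              linear_combination a ^ 2 * hpq
            have hd2 : d ^ 2 ≤ 1 / 4 := by
              have := abs_le.1 hd'
              nlinarith
            have h1 : d ^ 2 / p ≤ 1 := (div_le_one hp0).2 (hd2.trans hp4)
            have h2 : d ^ 2 / q ≤ 1 := (div_le_one hq0).2 (hd2.trans hq4)
            have h3 : θ m ^ 2 * (d ^ 2 / p + d ^ 2 / q) ≤ θ m ^ 2 * 2 :=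
              mul_le_mul_of_nonneg_left (by linarith) (sq_nonneg _)
            have h4 : p * (2 * Q) + q * (2 * Q) = 2 * Q := by rw [← add_mul, hpq, one_mul]
            rw [hr₁sq, hr₂sq] at hjensen
            linarith

end BiasedTrees

/-! ### The limit norm -/

section Renorming

variable {X : Type*} [NormedAddCommGroup X] [NormedSpace ℝ X]

/-- A copy of `ℓ₁` contains a bounded sequence on which the dual ball takes all finite patterns with
values in `[-1, 1]`. -/
theorem ContainsIsomorphicCopyOfEllOne.exists_seq (hX : ContainsIsomorphicCopyOfEllOne X) :
    ∃ (e : ℕ → X) (R : ℝ), (∀ n, ‖e n‖ ≤ R) ∧ ∀ (m : ℕ) (s : ℕ → ℝ), (∀ i, |s i| ≤ 1) →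
      ∃ φ : StrongDual ℝ X, ‖φ‖ ≤ 1 ∧ ∀ i < m, φ (e i) = s i := by
  obtain ⟨Z, ⟨T⟩⟩ := hX
  let S : Z →L[ℝ] lp (fun _ : ℕ => ℝ) 1 := T.symm
  -- Scaling the basis by `K` allows the extended functionals to be divided by `K`, into the unit
  -- ball; the `+ 1` keeps `K` positive.
  set K := ‖S‖ + 1 with hK
  have hK0 : 0 < K := by positivity
  let u : ℕ → lp (fun _ : ℕ => ℝ) 1 := fun n => lp.single 1 n (1 : ℝ)
  have hu : ∀ n, ‖u n‖ = 1 := fun n => by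
    simp [u, lp.norm_single]
  refine ⟨fun n => K • (T (u n) : X), K * ‖(T : lp (fun _ : ℕ => ℝ) 1 →L[ℝ] Z)‖, ?_, ?_⟩
  · intro n
    rw [norm_smul, Real.norm_of_nonneg hK0.le]
    gcongr
    have := (T : lp (fun _ : ℕ => ℝ) 1 →L[ℝ] Z).le_opNorm (u n)
    rwa [hu, mul_one] at this
  · intro m s hs
    let l : lp (fun _ : ℕ => ℝ) 1 →ₗ[ℝ] ℝ :=
      { toFun := fun a => ∑ i ∈ Finset.range m, s i * a i
        map_add' := fun a b => by
          simp [mul_add, Finset.sum_add_distrib]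
        map_smul' := fun c a => by
          simp only [lp.coeFn_smul, Pi.smul_apply, smul_eq_mul, RingHom.id_apply, Finset.mul_sum]
          exact Finset.sum_congr rfl fun i _ => by ring }
    have hl : ∀ a, |l a| ≤ ‖a‖ := by
      intro a
      calc |l a| ≤ ∑ i ∈ Finset.range m, |s i * a i| :=
            Finset.abs_sum_le_sum_abs (fun i => s i * a i) (Finset.range m)
        _ ≤ ∑ i ∈ Finset.range m, ‖a i‖ := by
            refine Finset.sum_le_sum fun i _ => ?_
            rw [abs_mul]
            exact mul_le_of_le_one_left (abs_nonneg _) (hs i)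
        _ ≤ ‖a‖ := by
            have := lp.sum_rpow_le_norm_rpow (p := 1) (by simp) a (Finset.range m)
            simpa using this
    let f : StrongDual ℝ Z := (l.comp S.toLinearMap).mkContinuous ‖S‖ (fun z => by
      rw [Real.norm_eq_abs]
      exact (hl (S z)).trans (S.le_opNorm z))
    obtain ⟨φ, hφ, hφn⟩ := exists_extension_norm_eq Z f
    refine ⟨K⁻¹ • φ, ?_, ?_⟩
    · rw [norm_smul, norm_inv, Real.norm_of_nonneg hK0.le, hφn, inv_mul_le_one₀ hK0]
      refine (LinearMap.mkContinuous_norm_le _ (norm_nonneg S) _).trans ?_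
      linarith
    · intro i hi
      have h1 : φ (T (u i)) = s i := by
        rw [hφ]
        change l (T.symm (T (u i))) = s i
        rw [T.symm_apply_apply]
        change ∑ j ∈ Finset.range m, s j * (u i) j = s i
        rw [Finset.sum_eq_single i]
        · simp [u]
        · intro j _ hj
          simp [u, hj]
        · intro h
          exact absurd (Finset.mem_range.2 hi) h
      simp [h1, hK0.ne']

/-- A sequence of bounded norming sets whose functionals are, asymptotically, averages of functionals
norming the `y n` defines in the limit an equivalent norm with octahedral bidual. -/
theorem exists_equivalentNorm_of_norming_sets (C : ℕ → Set (StrongDual ℝ X)) (y : ℕ → X) {c M : ℝ}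
    (hc : 0 < c) (hM : ∀ L, ∀ f ∈ C L, ‖f‖ ≤ M) (hcC : ∀ L x, ∃ f ∈ C L, c * ‖x‖ ≤ |f x|)
    (hy : ∀ L, ∀ n < L, ∀ f ∈ C L, |f (y n)| ≤ 1)
    (havg : ∀ L, ∀ N ≤ L, ∀ f ∈ C L, ∀ v : ℝ, |v| = 1 → ∃ F : ℕ → StrongDual ℝ X,
      (∀ n < N, F n ∈ C L ∧ F n (y n) = v) ∧
        ‖∑ n ∈ Finset.range N, (F n - f)‖ ≤ √(2 * N)) :
    ∃ p : EquivalentNorm X, IsOctahedral (StrongDual ℝ (StrongDual ℝ p.Renormed)) := by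
  have hne : ∀ L, (C L).Nonempty := fun L => let ⟨f, hf, _⟩ := hcC L 0; ⟨f, hf⟩
  have hM0 : 0 ≤ M := by
    obtain ⟨f, hf⟩ := hne 0
    exact (norm_nonneg f).trans (hM 0 f hf)
  have hfM : ∀ L, ∀ f ∈ C L, ∀ x, |f x| ≤ M * ‖x‖ := fun L f hf x => f.le_of_opNorm_le (hM L f hf) x
  let P : ℕ → X → ℝ := fun L x => sSup ((fun f : StrongDual ℝ X => |f x|) '' C L)
  have hbdd : ∀ L x, BddAbove ((fun f : StrongDual ℝ X => |f x|) '' C L) := fun L x =>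
    ⟨M * ‖x‖, by rintro _ ⟨f, hf, rfl⟩; exact hfM L f hf x⟩
  have hPle : ∀ L x a, (∀ f ∈ C L, |f x| ≤ a) → P L x ≤ a := fun L x a h =>
    csSup_le ((hne L).image _) (by rintro _ ⟨f, hf, rfl⟩; exact h f hf)
  have hleP : ∀ L x, ∀ f ∈ C L, |f x| ≤ P L x := fun L x f hf =>
    le_csSup (hbdd L x) ⟨f, hf, rfl⟩
  have hPM : ∀ L x, P L x ≤ M * ‖x‖ := fun L x => hPle L x _ fun f hf => hfM L f hf x
  have hcP : ∀ L x, c * ‖x‖ ≤ P L x := fun L x =>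
    let ⟨f, hf, h⟩ := hcC L x
    h.trans (hleP L x f hf)
  have hlim : ∀ x, ∃ a, Tendsto (fun L => P L x) (hyperfilter ℕ) (𝓝 a) := by
    intro x
    obtain ⟨a, -, ha⟩ := (isCompact_Icc (a := c * ‖x‖) (b := M * ‖x‖)).ultrafilter_le_nhds
      ((hyperfilter ℕ).map fun L => P L x)
      (le_principal_iff.2 (Filter.mem_map.2 (Filter.univ_mem' fun L => ⟨hcP L x, hPM L x⟩)))
    exact ⟨a, ha⟩
  choose p hp using hlim
  have hadd : ∀ x z, p (x + z) ≤ p x + p z := fun x z =>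
    le_of_tendsto_of_tendsto' (hp (x + z)) ((hp x).add (hp z)) fun L => hPle L _ _ fun f hf => by
      rw [map_add]
      exact (abs_add_le _ _).trans (add_le_add (hleP L x f hf) (hleP L z f hf))
  have hPsmul : ∀ L (a : ℝ) x, P L (a • x) ≤ |a| * P L x := fun L a x => hPle L _ _ fun f hf => by
    rw [map_smul, smul_eq_mul, abs_mul]
    exact mul_le_mul_of_nonneg_left (hleP L x f hf) (abs_nonneg a)
  have hsmul : ∀ (a : ℝ) x, p (a • x) ≤ ‖a‖ * p x := fun a x =>
    le_of_tendsto_of_tendsto' (hp (a • x)) ((hp x).const_mul |a|) fun L => hPsmul L a x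
  have hpM : ∀ x, p x ≤ M * ‖x‖ := fun x => le_of_tendsto' (hp x) fun L => hPM L x
  have hcp : ∀ x, c * ‖x‖ ≤ p x := fun x => ge_of_tendsto' (hp x) fun L => hcP L x
  have hp0 : p 0 = 0 := le_antisymm (by simpa using hpM 0) (by simpa using hcp 0)
  let q : EquivalentNorm X :=
    { toSeminorm := Seminorm.ofSMulLE p hp0 hadd hsmul
      equivalent := ⟨c, M + 1, hc, by positivity, fun x =>
        ⟨hcp x, (hpM x).trans (by nlinarith [norm_nonneg x])⟩⟩ }
  have hatTop : ∀ N : ℕ, ∀ᶠ L in (hyperfilter ℕ : Filter ℕ), N ≤ L := fun N =>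
    (Nat.hyperfilter_le_atTop : (hyperfilter ℕ : Filter ℕ) ≤ atTop) (eventually_ge_atTop N)
  have hpy : ∀ n, p (y n) ≤ 1 := fun n =>
    le_of_tendsto (hp (y n)) ((hatTop (n + 1)).mono fun L hL =>
      hPle L _ _ fun f hf => hy L n hL f hf)
  have hmain : ∀ (N : ℕ) (x : X) (t : ℝ), 0 ≤ t →
      N * (p x + t) ≤ ∑ n ∈ Finset.range N, p (x + t • y n) + √(2 * N) * ‖x‖ := by
    intro N x t ht
    refine le_of_tendsto_of_tendsto (((hp x).add_const t).const_mul (N : ℝ))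
      ((tendsto_finsetSum _ fun n _ => hp (x + t • y n)).add_const _)
      ((hatTop N).mono fun L hL => ?_)
    rcases N.eq_zero_or_pos with rfl | hN
    · simp
    have hN' : (0 : ℝ) < N := by exact_mod_cast hN
    suffices P L x ≤ (∑ n ∈ Finset.range N, P L (x + t • y n) + √(2 * N) * ‖x‖) / N - t by
      rw [le_sub_iff_add_le, le_div_iff₀ hN'] at this
      linarith
    refine hPle L _ _ fun f hf => ?_
    rw [le_sub_iff_add_le, le_div_iff₀ hN']
    -- Rebiasing towards the sign of `f x` makes the contributions of `x` and `t • y n` add up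
    -- rather than cancel.
    obtain ⟨v, hv, hfv⟩ : ∃ v : ℝ, |v| = 1 ∧ v * f x = |f x| := by
      rcases le_total 0 (f x) with h | h
      · exact ⟨1, by simp, by rw [abs_of_nonneg h, one_mul]⟩
      · exact ⟨-1, by simp, by rw [abs_of_nonpos h, neg_one_mul]⟩
    have hvv : v * v = 1 := by rw [← abs_mul_abs_self, hv, one_mul]
    obtain ⟨F, hF, hFn⟩ := havg L N hL f hf v hv
    have h1 : ∀ n ∈ Finset.range N, |f x| + t + v * (F n - f) x ≤ P L (x + t • y n) := by
      intro n hn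
      obtain ⟨hFC, hFy⟩ := hF n (Finset.mem_range.1 hn)
      refine le_trans ?_ (hleP L _ _ hFC)
      have : |f x| + t + v * (F n - f) x = v * F n (x + t • y n) := by
        rw [← hfv, map_add, map_smul, hFy, sub_apply, smul_eq_mul]
        linear_combination (-t) * hvv
      rw [this]
      refine (le_abs_self _).trans ?_
      rw [abs_mul, hv, one_mul]
    have h2 := Finset.sum_le_sum h1
    rw [Finset.sum_add_distrib, Finset.sum_const, Finset.card_range, nsmul_eq_mul,
      ← Finset.mul_sum, ← sum_apply] at h2
    have h3 : |v * (∑ n ∈ Finset.range N, (F n - f)) x| ≤ √(2 * N) * ‖x‖ := by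
      rw [abs_mul, hv, one_mul]
      exact ContinuousLinearMap.le_of_opNorm_le _ hFn x
    linarith [(abs_le.1 h3).1]
  refine ⟨q, isOctahedral_bidual_of_average (y := fun n => (show q.Renormed from y n)) ?_ ?_⟩
  · intro n
    refine le_antisymm (hpy n) ?_
    -- At `x = 0` the error vanishes: `n + 1` values, each at most `1`, sum to at least `n + 1`, so
    -- the last is `1`.
    have h1 := hmain (n + 1) 0 1 zero_le_one
    simp only [hp0, zero_add, mul_one, one_smul, norm_zero, mul_zero, add_zero] at h1
    rw [Finset.sum_range_succ] at h1
    have h2 : ∑ i ∈ Finset.range n, p (y i) ≤ n := by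
      refine (Finset.sum_le_sum fun i _ => hpy i).trans ?_
      simp
    push_cast at h1
    change 1 ≤ p (y n)
    linarith
  · intro η hη
    obtain ⟨N, hN⟩ := exists_nat_gt (2 / (η * c) ^ 2)
    have hN' : (0 : ℝ) < N := lt_of_le_of_lt (by positivity) hN
    refine ⟨N, by exact_mod_cast hN', fun x t ht => (hmain N x t ht).trans ?_⟩
    have h1 : √(2 * N) ≤ N * η * c := by
      rw [Real.sqrt_le_left (by positivity)]
      rw [div_lt_iff₀ (by positivity)] at hN
      nlinarith
    have h2 : √(2 * N) * ‖(show X from x)‖ ≤ N * η * p x :=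
      calc √(2 * N) * ‖(show X from x)‖ ≤ N * η * c * ‖(show X from x)‖ := by gcongr
        _ = N * η * (c * ‖(show X from x)‖) := by ring
        _ ≤ N * η * p x := by
          gcongr
          exact hcp x
    exact add_le_add_right h2 _

end Renorming

/-! ### The norming sets built from trees -/

theorem theorem4p2 {X : Type*} [NormedAddCommGroup X] [NormedSpace ℝ X] [CompleteSpace X]
    [TopologicalSpace.SeparableSpace X] (hX : ContainsIsomorphicCopyOfEllOne X) :
    ∃ p : EquivalentNorm X, IsOctahedral (StrongDual ℝ (StrongDual ℝ p.Renormed)) := by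
  obtain ⟨e, R, hR, he⟩ := hX.exists_seq
  have hR0 : 0 ≤ R := (norm_nonneg _).trans (hR 0)
  set ρ : ℝ := 1 / (4 * (R + 1)) with hρ
  have hρ0 : 0 < ρ := by positivity
  have hσe : ∀ σ : StrongDual ℝ X, ‖σ‖ ≤ ρ → ∀ i, |σ (e i)| ≤ 1 / 4 := by
    intro σ hσ i
    have h1 : |σ (e i)| ≤ ρ * ‖e i‖ := σ.le_of_opNorm_le hσ (e i)
    have h2 : ρ * (R + 1) = 1 / 4 := by
      rw [hρ]
      field_simp
    nlinarith [hR i]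
  refine exists_equivalentNorm_of_norming_sets
    (fun L => {f | ∃ σ : StrongDual ℝ X, ‖σ‖ ≤ ρ ∧ ∃ g ∈ biasedTree e σ L 0 0, f = σ + g})
    -- The factor `4` turns the band `1 / 4` for `σ + g` on `e n` into the bound `1` on `y n`.
    (fun n => (4 : ℝ) • e n) (c := ρ) (M := ρ + 1) hρ0 ?_ ?_ ?_ ?_
  · rintro L f ⟨σ, hσ, g, hg, rfl⟩
    exact (norm_add_le _ _).trans (add_le_add hσ (norm_le_of_mem_biasedTree (hσe σ hσ) hg))
  · intro L x
    obtain ⟨g, hg⟩ := exists_mem_biasedTree he L 0 (s := 0) (by simp)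
    obtain ⟨τ, hτ, hτx⟩ := exists_dual_vector'' ℝ x
    have hρτ : ‖ρ • τ‖ ≤ ρ := by
      rw [norm_smul, Real.norm_of_nonneg hρ0.le]
      exact mul_le_of_le_one_right hρ0.le hτ
    have hρτx : (ρ • τ) x = ρ * ‖x‖ := by
      rw [smul_apply, hτx]
      rfl
    have hρx : 0 ≤ ρ * ‖x‖ := by positivity
    -- The sign of `σ = ±ρ • τ` is matched to that of `g x`, so the tree part cannot cancel the
    -- lower bound `ρ * ‖x‖`.
    rcases le_total 0 (g x) with h | h
    · refine ⟨_, ⟨ρ • τ, hρτ, g, hg _ (hσe _ hρτ), rfl⟩, ?_⟩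
      rw [add_apply, hρτx]
      exact (le_add_of_nonneg_right h).trans (le_abs_self _)
    · have hneg : ‖-(ρ • τ)‖ ≤ ρ := by rwa [norm_neg]
      refine ⟨_, ⟨-(ρ • τ), hneg, g, hg _ (hσe _ hneg), rfl⟩, ?_⟩
      rw [add_apply, neg_apply, hρτx, abs_of_nonpos (by linarith)]
      linarith
  · rintro L n hn f ⟨σ, hσ, g, hg, rfl⟩
    have := abs_add_apply_le_of_mem_biasedTree (hσe σ hσ) hg (Nat.zero_le n) (by omega)
    rw [map_smul, smul_eq_mul, abs_mul, add_apply]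
    norm_num
    linarith
  · rintro L N hN f ⟨σ, hσ, g, hg, rfl⟩ v hv
    obtain ⟨F, hF, hFn⟩ := exists_rebias (hσe σ hσ) (v := v / 4)
      (by rw [abs_div, hv]; norm_num) hg
    refine ⟨fun n => σ + F n, fun n hn => ?_, ?_⟩
    · obtain ⟨h1, h2⟩ := hF n (Nat.zero_le n) (by omega)
      refine ⟨⟨σ, hσ, F n, h1, rfl⟩, ?_⟩
      rw [map_smul, smul_eq_mul, add_apply, h2]
      ring
    · have h1 := hFn (fun n => if n < N then 1 else 0) 0
      have h2 : (Finset.range L).filter (· < N) = Finset.range N := by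
        ext n
        simp only [Finset.mem_filter, Finset.mem_range]
        omega
      simpa [← Finset.sum_filter, h2, ite_smul, ite_pow] using h1
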